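/- Let $G$ be a discrete group, let $A_1$ and $A_2$ be unital C*-algebras, and let $\alpha_1:G\to\mathrm{Aut}(A_1)$ and $\alpha_2:G\to\mathrm{Aut}(A_2)$ be actions by $*$-automorphisms. Write $A_1*_{\mathbb C}A_2$ for the full unital free product amalgamated over the scalars. For an action $\beta$ of $G$ on a unital C*-algebra $A$, write $A\rtimes_\beta G$ for the full crossed product: the universal unital C*-algebra generated by the image of a unital $*$-homomorphism of $A$ and by unitaries $u^g$ ($g\in G$) with $u^{gh}=u^gu^h$ and $u^g a (u^g)^*=\beta_g(a)$. Let $C^*(G)$ be the full group C*-algebra, the universal C*-algebra generated by unitaries $U^g$ ($g\in G$) with $U^{gh}=U^gU^h$, and let $i_k:C^*(G)\to A_k\rtimes_{\alpha_k}G$ be the canonical unital $*$-homomorphism $U^g\mapsto u_k^g$, where $u_k^g$ are the canonical unitaries of $A_k\rtimes_{\alpha_k}G$. Let $$(A_1\rtimes_{\alpha_1}G)*_{C^*(G)}(A_2\rtimes_{\alpha_2}G)$$ be the full amalgamated free product along $i_1,i_2$: the universal unital C*-algebra generated by the images of unital $*$-homomorphisms $\varphi_k$ of $A_k\rtimes_{\alpha_k}G$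 ($k=1,2$) subject to $\varphi_1\circ i_1=\varphi_2\circ i_2$. Then there is a unique action $\alpha$ of $G$ on $A_1*_{\mathbb C}A_2$ by $*$-automorphisms that extends $\alpha_1$ and $\alpha_2$ (that is, $\alpha_g(a)=\alpha_{k,g}(a)$ for $g\in G$ and $a$ in the canonical image of $A_k$, $k=1,2$), and there is a $*$-isomorphism $$\Phi:(A_1*_{\mathbb C}A_2)\rtimes_\alpha G\;\longrightarrow\;(A_1\rtimes_{\alpha_1}G)*_{C^*(G)}(A_2\rtimes_{\alpha_2}G)$$ which is the canonical one: $\Phi(a)=\varphi_k(a)$ for $a\in A_k$, $k=1,2$, and $\Phi(u^g)=\varphi_1(u_1^g)=\varphi_2(u_2^g)$ for $g\in G$, where $u^g$ are the canonical unitaries of $(A_1*_{\mathbb C}A_2)\rtimes_\alpha G$. -/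

import Mathlib

open scoped NNReal

noncomputable section

/-! ### The free unital complex star-algebra on a set of generators -/

/-- The free unital complex `*`-algebra on a set `X`: the free complex algebra on two copies of
`X`, the second copy being the adjoints of the generators. -/
def FreeStarAlgebra (X : Type*) : Type _ := FreeAlgebra ℂ (X ⊕ X)

namespace FreeStarAlgebra

variable {X : Type*}

instance : Ring (FreeStarAlgebra X) := inferInstanceAs (Ring (FreeAlgebra ℂ (X ⊕ X)))

instance : Algebra ℂ (FreeStarAlgebra X) := inferInstanceAs (Algebra ℂ (FreeAlgebra ℂ (X ⊕ X)))

/-- The letters: `.inl x` is the generator `x`, and `.inr x` is its adjoint. -/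
def letter (x : X ⊕ X) : FreeStarAlgebra X := FreeAlgebra.ι ℂ x

/-- The generator `x`. -/
def of (x : X) : FreeStarAlgebra X := letter (.inl x)

theorem induction {motive : FreeStarAlgebra X → Prop}
    (scalar : ∀ c : ℂ, motive (algebraMap ℂ (FreeStarAlgebra X) c)) (letter : ∀ x : X ⊕ X, motive (letter x))
    (mul : ∀ a b, motive a → motive b → motive (a * b))
    (add : ∀ a b, motive a → motive b → motive (a + b)) (a : FreeStarAlgebra X) : motive a :=
  FreeAlgebra.induction ℂ (X ⊕ X) scalar letter mul add a

/-- The adjoint as a ring homomorphism to the opposite ring. -/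
def starHom : FreeStarAlgebra X →+* (FreeStarAlgebra X)ᵐᵒᵖ :=
  letI : Algebra ℂ (FreeStarAlgebra X)ᵐᵒᵖ :=
    ((algebraMap ℂ (FreeStarAlgebra X)ᵐᵒᵖ).comp (starRingEnd ℂ)).toAlgebra'
      fun c x => Algebra.commutes (starRingEnd ℂ c) x
  (FreeAlgebra.lift ℂ (A := (FreeStarAlgebra X)ᵐᵒᵖ)
    fun x : X ⊕ X => MulOpposite.op (letter x.swap)).toRingHom

theorem starHom_letter (x : X ⊕ X) : starHom (letter x) = MulOpposite.op (letter x.swap) := by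
  let : Algebra ℂ (FreeStarAlgebra X)ᵐᵒᵖ :=
    ((algebraMap ℂ (FreeStarAlgebra X)ᵐᵒᵖ).comp (starRingEnd ℂ)).toAlgebra'
      fun c x => Algebra.commutes (starRingEnd ℂ c) x
  exact FreeAlgebra.lift_ι_apply (R := ℂ) (A := (FreeStarAlgebra X)ᵐᵒᵖ) _ x

theorem starHom_algebraMap (c : ℂ) :
    starHom (algebraMap ℂ (FreeStarAlgebra X) c) =
      MulOpposite.op (algebraMap ℂ (FreeStarAlgebra X) (starRingEnd ℂ c)) := by
  let : Algebra ℂ (FreeStarAlgebra X)ᵐᵒᵖ :=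
    ((algebraMap ℂ (FreeStarAlgebra X)ᵐᵒᵖ).comp (starRingEnd ℂ)).toAlgebra'
      fun c x => Algebra.commutes (starRingEnd ℂ c) x
  exact (FreeAlgebra.lift ℂ (A := (FreeStarAlgebra X)ᵐᵒᵖ)
    fun x : X ⊕ X => MulOpposite.op (letter x.swap)).commutes c

/-- The conjugate-linear involution reversing words and exchanging `x` with its adjoint. -/
instance : StarRing (FreeStarAlgebra X) where
  star a := (starHom a).unop
  star_involutive a := by
    induction a using induction with
    | scalar c => simp [starHom_algebraMap]
    | letter x => simp [starHom_letter]
    | mul a b ha hb => simp [ha, hb]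
    | add a b ha hb => simp [ha, hb]
  star_mul a b := by simp
  star_add a b := by simp

theorem star_letter (x : X ⊕ X) : star (letter x) = letter x.swap :=
  congrArg MulOpposite.unop (starHom_letter x)

theorem star_algebraMap' (c : ℂ) :
    star (algebraMap ℂ (FreeStarAlgebra X) c) = algebraMap ℂ _ (star c) :=
  congrArg MulOpposite.unop (starHom_algebraMap c)

instance : StarModule ℂ (FreeStarAlgebra X) where
  star_smul c a := by
    rw [Algebra.smul_def, star_mul, star_algebraMap', Algebra.smul_def, Algebra.commutes]

section eval

variable {B : Type*} [Ring B] [StarRing B] [Algebra ℂ B] (f : X → B)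

/-- Evaluation of `*`-polynomials at a family `f`, as an algebra homomorphism. -/
def evalAlgHom : FreeStarAlgebra X →ₐ[ℂ] B := FreeAlgebra.lift ℂ (Sum.elim f fun x => star (f x))

theorem evalAlgHom_letter (x : X ⊕ X) :
    evalAlgHom f (letter x) = Sum.elim f (fun x => star (f x)) x :=
  FreeAlgebra.lift_ι_apply (R := ℂ) (Sum.elim f fun x => star (f x)) x

variable [StarModule ℂ B]

theorem evalAlgHom_star (a : FreeStarAlgebra X) :
    evalAlgHom f (star a) = star (evalAlgHom f a) := by
  induction a using induction with
  | scalar c => rw [star_algebraMap', AlgHom.commutes, AlgHom.commutes, algebraMap_star_comm]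
  | letter x => rw [star_letter, evalAlgHom_letter, evalAlgHom_letter]; cases x <;> simp
  | mul a b ha hb => simp [ha, hb]
  | add a b ha hb => simp [ha, hb]

/-- Evaluation of `*`-polynomials at a family `f` in a complex `*`-algebra. -/
def eval : FreeStarAlgebra X →⋆ₐ[ℂ] B where
  toAlgHom := evalAlgHom f
  map_star' := evalAlgHom_star f

theorem eval_of (x : X) : eval f (of x) = f x := evalAlgHom_letter f (.inl x)

end eval

end FreeStarAlgebra

/-! ### The universal C*-algebra of a presentation -/

/-- Generators `X`, an upper bound for the norm of each generator, and relations `a = b` between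
`*`-polynomials in the generators. -/
structure CStarPresentation (X : Type*) where
  bound : X → ℝ≥0
  rel : FreeStarAlgebra X → FreeStarAlgebra X → Prop

namespace CStarPresentation

variable {X : Type*} (P : CStarPresentation X)

/-- The C*-seminorms on the free `*`-algebra which respect the bounds and the relations. -/
structure IsAdmissible (p : Seminorm ℂ (FreeStarAlgebra X)) : Prop where
  mul_le : ∀ a b, p (a * b) ≤ p a * p b
  star_mul_self : ∀ a, p (star a * a) = p a * p a
  of_le : ∀ x, p (.of x) ≤ P.bound x
  rel : ∀ a b, P.rel a b → p (a - b) = 0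

theorem isAdmissible_zero : P.IsAdmissible 0 := by constructor <;> simp

instance : Nonempty {p // P.IsAdmissible p} := ⟨⟨0, P.isAdmissible_zero⟩⟩

variable {P}

theorem IsAdmissible.star {p} (hp : P.IsAdmissible p) (a) : p (star a) = p a := by
  have key : ∀ a, p a ≤ p (Star.star a) := fun a => by
    rcases (apply_nonneg p a).eq_or_lt with h | h
    · rw [← h]; exact apply_nonneg _ _
    · have := hp.star_mul_self a ▸ hp.mul_le (Star.star a) a
      exact le_of_mul_le_mul_right this h
  exact le_antisymm (by simpa using key (Star.star a)) (key a)

theorem IsAdmissible.one {p} (hp : P.IsAdmissible p) : p 1 ≤ 1 := by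
  have h := hp.star_mul_self 1
  simp only [star_one, one_mul] at h
  nlinarith [sq_nonneg (p 1 - 1)]

variable (P)

theorem bddAbove (a) :
    BddAbove (Set.range fun p : {p // P.IsAdmissible p} => p.1 a) := by
  suffices h : ∃ C : ℝ, ∀ p, P.IsAdmissible p → p a ≤ C by
    obtain ⟨C, hC⟩ := h
    exact ⟨C, by rintro _ ⟨p, rfl⟩; exact hC p p.2⟩
  induction a using FreeStarAlgebra.induction with
  | scalar c =>
    refine ⟨‖c‖, fun p hp => ?_⟩
    rw [Algebra.algebraMap_eq_smul_one, map_smul_eq_mul]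
    exact mul_le_of_le_one_right (norm_nonneg _) hp.one
  | letter x =>
    cases x with
    | inl x => exact ⟨P.bound x, fun p hp => hp.of_le x⟩
    | inr x =>
      refine ⟨P.bound x, fun p hp => ?_⟩
      have := hp.star (FreeStarAlgebra.of x)
      rw [FreeStarAlgebra.of, FreeStarAlgebra.star_letter] at this
      exact this.trans_le (hp.of_le x)
  | mul a b ha hb =>
    obtain ⟨C, hC⟩ := ha
    obtain ⟨D, hD⟩ := hb
    exact ⟨C * D, fun p hp => (hp.mul_le a b).trans (mul_le_mul (hC p hp) (hD p hp)
      (apply_nonneg _ _) ((apply_nonneg _ _).trans (hC p hp)))⟩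
  | add a b ha hb =>
    obtain ⟨C, hC⟩ := ha
    obtain ⟨D, hD⟩ := hb
    exact ⟨C + D, fun p hp => (map_add_le_add p a b).trans (add_le_add (hC p hp) (hD p hp))⟩

/-- The largest admissible C*-seminorm, the pointwise supremum of all of them. -/
def universalSeminorm : Seminorm ℂ (FreeStarAlgebra X) :=
  Seminorm.of (fun a => ⨆ p : {p // P.IsAdmissible p}, p.1 a)
    (fun a b => ciSup_le fun p => (map_add_le_add _ a b).trans
      (add_le_add (le_ciSup (P.bddAbove a) p) (le_ciSup (P.bddAbove b) p)))
    (fun c a => by simp only [map_smul_eq_mul]; rw [Real.mul_iSup_of_nonneg (norm_nonneg _)])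

theorem universalSeminorm_apply (a) :
    P.universalSeminorm a = ⨆ p : {p // P.IsAdmissible p}, p.1 a := rfl

theorem IsAdmissible.le_universal {P : CStarPresentation X} {p} (hp : P.IsAdmissible p) (a) :
    p a ≤ P.universalSeminorm a := le_ciSup (P.bddAbove a) ⟨p, hp⟩

theorem universalSeminorm_mul_le (a b) :
    P.universalSeminorm (a * b) ≤ P.universalSeminorm a * P.universalSeminorm b :=
  ciSup_le fun p => (p.2.mul_le a b).trans (mul_le_mul (p.2.le_universal a) (p.2.le_universal b)
    (apply_nonneg _ _) (apply_nonneg _ _))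

theorem universalSeminorm_star (a) : P.universalSeminorm (star a) = P.universalSeminorm a := by
  simp only [universalSeminorm_apply]
  exact iSup_congr fun p => p.2.star a

theorem universalSeminorm_mul_self_le (a) :
    P.universalSeminorm a * P.universalSeminorm a ≤ P.universalSeminorm (star a * a) := by
  have h : P.universalSeminorm a ≤ √(P.universalSeminorm (star a * a)) :=
    ciSup_le fun p => Real.le_sqrt_of_sq_le <| by
      rw [sq, ← p.2.star_mul_self]; exact p.2.le_universal _
  calc _ ≤ _ := mul_self_le_mul_self (apply_nonneg _ _) h
    _ = _ := Real.mul_self_sqrt (apply_nonneg _ _)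

theorem universalSeminorm_rel {a b} (h : P.rel a b) : P.universalSeminorm (a - b) = 0 :=
  le_antisymm (ciSup_le fun p => (p.2.rel a b h).le) (apply_nonneg _ _)

/-- The free `*`-algebra on `X`, equipped with the universal seminorm. -/
def Pre (_P : CStarPresentation X) : Type _ := FreeStarAlgebra X

instance : Ring P.Pre := inferInstanceAs (Ring (FreeStarAlgebra X))
instance : Algebra ℂ P.Pre := inferInstanceAs (Algebra ℂ (FreeStarAlgebra X))
instance : StarRing P.Pre := inferInstanceAs (StarRing (FreeStarAlgebra X))
instance : StarModule ℂ P.Pre := inferInstanceAs (StarModule ℂ (FreeStarAlgebra X))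

instance : SeminormedRing P.Pre :=
  { (inferInstance : Ring P.Pre),
    P.universalSeminorm.toAddGroupSeminorm.toSeminormedAddCommGroup with
    norm_mul_le := P.universalSeminorm_mul_le }

instance : NormedAlgebra ℂ P.Pre where
  norm_smul_le c a := (map_smul_eq_mul P.universalSeminorm c a).le

instance : NormedStarGroup P.Pre where
  norm_star_le a := (P.universalSeminorm_star a).le

end CStarPresentation

/-- The universal C*-algebra of a presentation: the Hausdorff completion of the free `*`-algebra
for the largest admissible C*-seminorm. -/
def UniversalCStar {X : Type*} (P : CStarPresentation X) : Type _ :=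
  UniformSpace.Completion P.Pre

namespace UniversalCStar

open UniformSpace

variable {X : Type*} {P : CStarPresentation X}

instance : NormedRing (UniversalCStar P) := inferInstanceAs (NormedRing (Completion P.Pre))

instance : CompleteSpace (UniversalCStar P) :=
  inferInstanceAs (CompleteSpace (Completion P.Pre))

instance : Algebra ℂ (UniversalCStar P) := inferInstanceAs (Algebra ℂ (Completion P.Pre))

instance : NormedAlgebra ℂ (UniversalCStar P) where
  norm_smul_le := norm_smul_le (α := ℂ) (β := Completion P.Pre)

/-- The class of a `*`-polynomial in the universal C*-algebra. -/
def mk (P : CStarPresentation X) (a : FreeStarAlgebra X) : UniversalCStar P :=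
  Completion.coe' (α := P.Pre) a

theorem norm_mk (a : FreeStarAlgebra X) : ‖mk P a‖ = P.universalSeminorm a :=
  Completion.norm_coe (E := P.Pre) a

theorem mk_add (a b) : mk P (a + b) = mk P a + mk P b := Completion.coe_add (α := P.Pre) a b
theorem mk_mul (a b) : mk P (a * b) = mk P a * mk P b := Completion.coe_mul (α := P.Pre) a b
theorem mk_sub (a b) : mk P (a - b) = mk P a - mk P b := Completion.coe_sub (α := P.Pre) a b
theorem mk_one : mk P 1 = 1 := Completion.coe_one P.Pre
theorem mk_smul (c : ℂ) (a) : mk P (c • a) = c • mk P a :=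
  Completion.coe_smul (M := ℂ) (X := P.Pre) c a

theorem induction {motive : UniversalCStar P → Prop} (closed : IsClosed {a | motive a})
    (mk : ∀ a, motive (mk P a)) (a : UniversalCStar P) : motive a :=
  Completion.induction_on (α := P.Pre) a closed mk

/-- The continuous extension of the adjoint. -/
instance : Star (UniversalCStar P) := ⟨Completion.map (star : P.Pre → P.Pre)⟩

theorem continuous_star : Continuous (star : UniversalCStar P → UniversalCStar P) :=
  Completion.continuous_map

theorem star_mk (a) : star (mk P a) = mk P (star a) :=
  Completion.map_coe (α := P.Pre) (β := P.Pre) (starₗᵢ ℂ).isometry.uniformContinuous a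

instance : StarRing (UniversalCStar P) where
  star_involutive a := by
    induction a using induction with
    | closed => exact isClosed_eq (continuous_star.comp continuous_star) continuous_id
    | mk a => simp [star_mk]
  star_mul a b := by
    induction a using induction with
    | closed =>
      exact isClosed_eq (continuous_star.comp (continuous_mul_const b))
        (continuous_star.const_mul (star b))
    | mk a =>
      induction b using induction with
      | closed =>
        exact isClosed_eq (continuous_star.comp (continuous_const_mul _))
          (continuous_star.mul_const _)
      | mk b => simp [star_mk, ← mk_mul]
  star_add a b := by
    induction a using induction with
    | closed =>
      exact isClosed_eq (continuous_star.comp (continuous_add_const b))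
        (continuous_star.add continuous_const)
    | mk a =>
      induction b using induction with
      | closed =>
        exact isClosed_eq (continuous_star.comp (continuous_const_add _))
          (continuous_const.add continuous_star)
      | mk b => simp [star_mk, ← mk_add]

instance : StarModule ℂ (UniversalCStar P) where
  star_smul c a := by
    induction a using induction with
    | closed =>
      exact isClosed_eq (continuous_star.comp (continuous_const_smul c))
        (continuous_star.const_smul (star c))
    | mk a => simp [star_mk, ← mk_smul]

instance : CStarRing (UniversalCStar P) where
  norm_mul_self_le a := by
    induction a using induction with
    | closed =>
      exact isClosed_le (continuous_norm.mul continuous_norm)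
        (continuous_norm.comp (continuous_star.mul continuous_id))
    | mk a =>
      rw [star_mk, ← mk_mul, norm_mk, norm_mk]
      exact P.universalSeminorm_mul_self_le a

instance : CStarAlgebra (UniversalCStar P) where

/-- The generator `x` in the universal C*-algebra. -/
def gen (P : CStarPresentation X) (x : X) : UniversalCStar P := mk P (.of x)

theorem norm_gen_le (x : X) : ‖gen P x‖ ≤ P.bound x :=
  (norm_mk (P := P) _).trans_le (ciSup_le fun p => p.2.of_le x)

theorem mk_eq_mk {a b} (h : P.rel a b) : mk P a = mk P b := by
  rw [← sub_eq_zero, ← mk_sub, ← norm_eq_zero, norm_mk, P.universalSeminorm_rel h]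

section lift

variable {B : Type*} [CStarAlgebra B] (f : X → B)

theorem isAdmissible_eval (hb : ∀ x, ‖f x‖ ≤ P.bound x)
    (hr : ∀ a b, P.rel a b → FreeStarAlgebra.eval f a = FreeStarAlgebra.eval f b) :
    P.IsAdmissible ((normSeminorm ℂ B).comp
      (FreeStarAlgebra.eval f).toAlgHom.toLinearMap) where
  mul_le a b := by
    change ‖FreeStarAlgebra.eval f (a * b)‖ ≤
      ‖FreeStarAlgebra.eval f a‖ * ‖FreeStarAlgebra.eval f b‖
    rw [map_mul]; exact norm_mul_le _ _
  star_mul_self a := by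
    change ‖FreeStarAlgebra.eval f (star a * a)‖ =
      ‖FreeStarAlgebra.eval f a‖ * ‖FreeStarAlgebra.eval f a‖
    rw [map_mul, map_star]; exact CStarRing.norm_star_mul_self
  of_le x := by
    change ‖FreeStarAlgebra.eval f (.of x)‖ ≤ _
    rw [FreeStarAlgebra.eval_of]; exact hb x
  rel a b h := by
    change ‖FreeStarAlgebra.eval f (a - b)‖ = 0
    rw [map_sub, hr a b h, sub_self, norm_zero]

/-- Evaluation at `f`, as a ring homomorphism on the seminormed ring `P.Pre`. -/
def evalPre (P : CStarPresentation X) : P.Pre →+* B := (FreeStarAlgebra.evalAlgHom f).toRingHom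

theorem continuous_evalPre (hb : ∀ x, ‖f x‖ ≤ P.bound x)
    (hr : ∀ a b, P.rel a b → FreeStarAlgebra.eval f a = FreeStarAlgebra.eval f b) :
    Continuous (evalPre f P) :=
  AddMonoidHomClass.continuous_of_bound (evalPre f P) 1 fun a => by
    rw [one_mul]; exact (isAdmissible_eval f hb hr).le_universal a

/-- The universal property: a family `f` in a unital C*-algebra which satisfies the bounds and
the relations extends to a unital `*`-homomorphism. -/
def lift (hb : ∀ x, ‖f x‖ ≤ P.bound x)
    (hr : ∀ a b, P.rel a b → FreeStarAlgebra.eval f a = FreeStarAlgebra.eval f b) :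
    UniversalCStar P →⋆ₐ[ℂ] B :=
  have hc := continuous_evalPre f hb hr
  let φ : UniversalCStar P →+* B := Completion.extensionHom (evalPre f P) hc
  have hφc : Continuous φ := Completion.continuous_extension (f := evalPre f P)
  have hφ : ∀ a, φ (mk P a) = FreeStarAlgebra.eval f a :=
    fun a => Completion.extensionHom_coe (evalPre f P) hc a
  { φ with
    commutes' := fun c => by
      change φ (algebraMap ℂ _ c) = _
      rw [Algebra.algebraMap_eq_smul_one, ← mk_one, ← mk_smul, hφ, map_smul, map_one,
        Algebra.algebraMap_eq_smul_one]
    map_star' := fun a => by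
      change φ (star a) = star (φ a)
      induction a using induction with
      | closed => exact isClosed_eq (hφc.comp continuous_star) hφc.star
      | mk a => rw [star_mk, hφ, hφ, map_star] }

theorem lift_gen (hb : ∀ x, ‖f x‖ ≤ P.bound x)
    (hr : ∀ a b, P.rel a b → FreeStarAlgebra.eval f a = FreeStarAlgebra.eval f b) (x : X) :
    lift f hb hr (gen P x) = f x :=
  (Completion.extensionHom_coe (evalPre f P) (continuous_evalPre f hb hr) _).trans (FreeStarAlgebra.eval_of f x)

end lift

end UniversalCStar

/-! ### Standard relations -/

section Relations

open FreeStarAlgebra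

/-- The relations saying that `j : A → X` is a unital `*`-homomorphism. -/
inductive StarAlgRel {A X : Type*} [CStarAlgebra A] (j : A → X) :
    FreeStarAlgebra X → FreeStarAlgebra X → Prop
  | one : StarAlgRel j (of (j 1)) 1
  | add (a b : A) : StarAlgRel j (of (j (a + b))) (of (j a) + of (j b))
  | smul (c : ℂ) (a : A) : StarAlgRel j (of (j (c • a))) (c • of (j a))
  | mul (a b : A) : StarAlgRel j (of (j (a * b))) (of (j a) * of (j b))
  | star (a : A) : StarAlgRel j (of (j (star a))) (star (of (j a)))

/-- The relations saying that `u : G → X` is a unitary representation. -/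
inductive UnitaryRel {G X : Type*} [Group G] (u : G → X) :
    FreeStarAlgebra X → FreeStarAlgebra X → Prop
  | one : UnitaryRel u (of (u 1)) 1
  | mul (g h : G) : UnitaryRel u (of (u (g * h))) (of (u g) * of (u h))
  | star (g : G) : UnitaryRel u (star (of (u g))) (of (u g⁻¹))

variable {X : Type*} (P : CStarPresentation X)

/-- The `*`-homomorphism given by generators that satisfy the `*`-algebra relations. -/
def UniversalCStar.starAlgHom {A : Type*} [CStarAlgebra A] (j : A → X)
    (h : ∀ a b, StarAlgRel j a b → P.rel a b) : A →⋆ₐ[ℂ] UniversalCStar P :=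
  have hsmul : ∀ (c : ℂ) a, gen P (j (c • a)) = c • gen P (j a) :=
    fun c a => (mk_eq_mk (h _ _ (.smul c a))).trans (mk_smul c _)
  have hone : gen P (j 1) = 1 := (mk_eq_mk (h _ _ .one)).trans mk_one
  { toFun a := gen P (j a)
    map_one' := hone
    map_mul' a b := (mk_eq_mk (h _ _ (.mul a b))).trans (mk_mul _ _)
    map_zero' := by simpa using hsmul 0 0
    map_add' a b := (mk_eq_mk (h _ _ (.add a b))).trans (mk_add _ _)
    commutes' c := by
      rw [Algebra.algebraMap_eq_smul_one, hsmul, hone, Algebra.algebraMap_eq_smul_one]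
    map_star' a := (mk_eq_mk (h _ _ (.star a))).trans (star_mk _).symm }

/-- The unitary representation given by generators that satisfy the unitary relations. -/
def UniversalCStar.unitaryHom {G : Type*} [Group G] (u : G → X)
    (h : ∀ a b, UnitaryRel u a b → P.rel a b) : G →* unitary (UniversalCStar P) :=
  have hone : gen P (u 1) = 1 := (mk_eq_mk (h _ _ .one)).trans mk_one
  have hmul : ∀ g k, gen P (u (g * k)) = gen P (u g) * gen P (u k) :=
    fun g k => (mk_eq_mk (h _ _ (.mul g k))).trans (mk_mul _ _)
  have hstar : ∀ g, star (gen P (u g)) = gen P (u g⁻¹) :=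
    fun g => (star_mk _).trans (mk_eq_mk (h _ _ (.star g)))
  { toFun g := ⟨gen P (u g), by
      rw [Unitary.mem_iff, hstar, ← hmul, ← hmul, inv_mul_cancel, mul_inv_cancel, hone]
      exact ⟨rfl, rfl⟩⟩
    map_one' := Subtype.ext hone
    map_mul' g k := Subtype.ext (hmul g k) }

end Relations

/-! ### Group C*-algebras, crossed products and amalgamated free products -/

open FreeStarAlgebra UniversalCStar

/-- Generators `u_g` for `g` in `G`; relations: `g ↦ u_g` is a unitary representation. -/
def groupPresentation (G : Type*) [Group G] : CStarPresentation G where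
  bound _ := 1
  rel := UnitaryRel id

/-- The full group C*-algebra `C*(G)` of a discrete group. -/
abbrev GroupCStar (G : Type*) [Group G] := UniversalCStar (groupPresentation G)

/-- The canonical unitaries of `C*(G)`. -/
def GroupCStar.unitaries (G : Type*) [Group G] : G →* unitary (GroupCStar G) :=
  unitaryHom (groupPresentation G) id fun _ _ h => h

section CrossedProduct

variable {A G : Type*} [CStarAlgebra A] [Group G] (α : G →* (A ≃⋆ₐ[ℂ] A))

/-- The relations of a crossed product: those of `A`, those of a unitary representation of `G`,
and the covariance relation `u_g a u_g* = α_g(a)`. -/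
inductive CrossedProductRel : FreeStarAlgebra (A ⊕ G) → FreeStarAlgebra (A ⊕ G) → Prop
  | alg {x y} : StarAlgRel Sum.inl x y → CrossedProductRel x y
  | grp {x y} : UnitaryRel Sum.inr x y → CrossedProductRel x y
  | cov (g : G) (a : A) : CrossedProductRel
      (of (.inr g) * of (.inl a) * star (of (.inr g))) (of (.inl (α g a)))

/-- Generators: the elements `a` of `A`, and `u_g` for `g` in `G`. -/
def crossedPresentation : CStarPresentation (A ⊕ G) where
  bound := Sum.elim (fun a => ‖a‖₊) fun _ => 1
  rel := CrossedProductRel α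

/-- The full crossed product `A ⋊_α G` by a discrete group. -/
abbrev CrossedProduct := UniversalCStar (crossedPresentation α)

/-- The canonical map of `A` into `A ⋊_α G`. -/
def CrossedProduct.incl : A →⋆ₐ[ℂ] CrossedProduct α :=
  starAlgHom (crossedPresentation α) Sum.inl fun _ _ => .alg

/-- The canonical unitaries of `A ⋊_α G`. -/
def CrossedProduct.unitaries : G →* unitary (CrossedProduct α) :=
  unitaryHom (crossedPresentation α) Sum.inr fun _ _ => .grp

/-- The canonical map of `C*(G)` into `A ⋊_α G`, sending `u_g` to `u_g`. -/
def CrossedProduct.groupIncl : GroupCStar G →⋆ₐ[ℂ] CrossedProduct α :=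
  lift (fun g => (unitaries α g : CrossedProduct α))
    (fun g => norm_gen_le (P := crossedPresentation α) (.inr g))
    (fun x y h => by
      cases h with
      | one => simp [eval_of]
      | mul g h => simp [eval_of]
      | star g =>
        rw [map_star, eval_of, eval_of, id, id, map_inv]
        rfl)

theorem CrossedProduct.groupIncl_unitaries (g : G) :
    groupIncl α (GroupCStar.unitaries G g : GroupCStar G) = (unitaries α g : CrossedProduct α) :=
  lift_gen _ _ _ g

end CrossedProduct

section FreeProduct

variable {C A₁ A₂ : Type*} [CStarAlgebra C] [CStarAlgebra A₁] [CStarAlgebra A₂]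
  (i₁ : C →⋆ₐ[ℂ] A₁) (i₂ : C →⋆ₐ[ℂ] A₂)

/-- The relations of an amalgamated free product: those of `A₁`, those of `A₂`, and the
identification of the two images of `C`. -/
inductive AmalgamatedRel : FreeStarAlgebra (A₁ ⊕ A₂) → FreeStarAlgebra (A₁ ⊕ A₂) → Prop
  | left {x y} : StarAlgRel Sum.inl x y → AmalgamatedRel x y
  | right {x y} : StarAlgRel Sum.inr x y → AmalgamatedRel x y
  | glue (c : C) : AmalgamatedRel (of (.inl (i₁ c))) (of (.inr (i₂ c)))

/-- Generators: the elements of `A₁` and those of `A₂`. -/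
def amalgamatedPresentation : CStarPresentation (A₁ ⊕ A₂) where
  bound := Sum.elim (fun a => ‖a‖₊) fun a => ‖a‖₊
  rel := AmalgamatedRel i₁ i₂

/-- The full unital free product `A₁ *_C A₂` amalgamated over `C` along `i₁` and `i₂`. -/
abbrev AmalgamatedFreeProduct := UniversalCStar (amalgamatedPresentation i₁ i₂)

/-- The canonical map of `A₁` into `A₁ *_C A₂`. -/
def AmalgamatedFreeProduct.inl : A₁ →⋆ₐ[ℂ] AmalgamatedFreeProduct i₁ i₂ :=
  starAlgHom (amalgamatedPresentation i₁ i₂) Sum.inl fun _ _ => .left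

/-- The canonical map of `A₂` into `A₁ *_C A₂`. -/
def AmalgamatedFreeProduct.inr : A₂ →⋆ₐ[ℂ] AmalgamatedFreeProduct i₁ i₂ :=
  starAlgHom (amalgamatedPresentation i₁ i₂) Sum.inr fun _ _ => .right

variable (A₁ A₂)

/-- The full unital free product `A₁ *_ℂ A₂`, amalgamated over the scalars. -/
abbrev FreeProductCStar :=
  AmalgamatedFreeProduct (StarAlgHom.ofId ℂ A₁) (StarAlgHom.ofId ℂ A₂)

/-- The canonical map of `A₁` into `A₁ *_ℂ A₂`. -/
def FreeProductCStar.inl : A₁ →⋆ₐ[ℂ] FreeProductCStar A₁ A₂ := AmalgamatedFreeProduct.inl _ _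

/-- The canonical map of `A₂` into `A₁ *_ℂ A₂`. -/
def FreeProductCStar.inr : A₂ →⋆ₐ[ℂ] FreeProductCStar A₁ A₂ := AmalgamatedFreeProduct.inr _ _

variable {A₁ A₂}

/-- The action `α` of `G` on `A₁ *_ℂ A₂` extends `α₁` and `α₂`. -/
def ExtendsActions {G : Type*} [Group G] (α₁ : G →* (A₁ ≃⋆ₐ[ℂ] A₁)) (α₂ : G →* (A₂ ≃⋆ₐ[ℂ] A₂))
    (α : G →* (FreeProductCStar A₁ A₂ ≃⋆ₐ[ℂ] FreeProductCStar A₁ A₂)) : Prop :=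
  (∀ g a, α g (FreeProductCStar.inl A₁ A₂ a) = FreeProductCStar.inl A₁ A₂ (α₁ g a)) ∧
    ∀ g a, α g (FreeProductCStar.inr A₁ A₂ a) = FreeProductCStar.inr A₁ A₂ (α₂ g a)

end FreeProduct

end

/-! Both algebras are universal for the same data. A unital `*`-homomorphism out of `(A₁ *_ℂ A₂) ⋊
G` is a covariant pair, that is, a pair of maps on `A₁` and `A₂` with one unitary representation of
`G` that implements both actions. A map out of the amalgamated product is a pair of maps on the two
crossed products that agree on `C*(G)`, that is, two covariant pairs with the same unitary
representation.

The action on the free product comes from functoriality of `*_ℂ`; it is unique because `A₁` and `A₂`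
generate.

In one direction, integration needs covariance on all of `A₁ *_ℂ A₂`, which
`coefficientHom_covariant` reduces to the two factors. In the other, the two maps of crossed
products glue because they agree on the unitaries that generate `C*(G)`. The maps `toAmalgam` and
`ofAmalgam` are mutually inverse because both composites fix generators. -/

noncomputable section

open FreeStarAlgebra UniversalCStar

/-! ### Universal properties: maps out are determined by generators and exist when the relations
hold. -/

section UniversalProperties

theorem FreeStarAlgebra.starAlgHom_ext {X B : Type*} [Ring B] [StarRing B] [Algebra ℂ B]
    {φ ψ : FreeStarAlgebra X →⋆ₐ[ℂ] B} (h : ∀ x, φ (of x) = ψ (of x)) : φ = ψ := by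
  ext a
  induction a using FreeStarAlgebra.induction with
  | scalar c => rw [AlgHomClass.commutes φ, AlgHomClass.commutes ψ]
  | letter x =>
    cases x with
    | inl x => exact h x
    | inr x =>
      have hx : letter (.inr x) = star (of x) := (star_letter (.inl x)).symm
      rw [hx, map_star, map_star, h]
  | mul a b ha hb => rw [map_mul, map_mul, ha, hb]
  | add a b ha hb => rw [map_add, map_add, ha, hb]

/-- The canonical map of the free `*`-algebra into the universal C*-algebra. -/
def UniversalCStar.mkHom {X : Type*} (P : CStarPresentation X) :
    FreeStarAlgebra X →⋆ₐ[ℂ] UniversalCStar P where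
  toFun := mk P
  map_one' := mk_one
  map_mul' := mk_mul
  map_zero' := by simpa using mk_smul (P := P) 0 0
  map_add' := mk_add
  commutes' c := by
    rw [Algebra.algebraMap_eq_smul_one, mk_smul, mk_one, Algebra.algebraMap_eq_smul_one]
  map_star' a := (star_mk a).symm

theorem starAlgHom_continuous {A B : Type*} [CStarAlgebra A] [CStarAlgebra B] (φ : A →⋆ₐ[ℂ] B) :
    Continuous φ :=
  AddMonoidHomClass.continuous_of_bound φ 1 fun a => by
    rw [one_mul]; exact NonUnitalStarAlgHom.norm_apply_le φ a

/-- The `*`-polynomials in the generators are dense, and `*`-homomorphisms of C*-algebras are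
contractive, hence continuous. -/
theorem UniversalCStar.hom_ext {X B : Type*} [CStarAlgebra B] {P : CStarPresentation X}
    {φ ψ : UniversalCStar P →⋆ₐ[ℂ] B} (h : ∀ x, φ (gen P x) = ψ (gen P x)) : φ = ψ := by
  have key : φ.comp (mkHom P) = ψ.comp (mkHom P) := FreeStarAlgebra.starAlgHom_ext h
  ext a
  induction a using UniversalCStar.induction with
  | closed => exact isClosed_eq (starAlgHom_continuous φ) (starAlgHom_continuous ψ)
  | mk a => exact DFunLike.congr_fun key a

/-- Discharges the algebra relations whenever `lift` is applied. Here `f` may be defined on further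
generators; only its restriction along `j` must be a `*`-homomorphism. -/
theorem StarAlgRel.eval_eq {A X B : Type*} [CStarAlgebra A] [CStarAlgebra B] {j : A → X}
    {f : X → B} {x y : FreeStarAlgebra X} (h : StarAlgRel j x y) (φ : A →⋆ₐ[ℂ] B)
    (hf : ∀ a, f (j a) = φ a) : eval f x = eval f y := by
  cases h <;> simp [eval_of, hf, map_star]

theorem UnitaryRel.eval_eq {G X B : Type*} [Group G] [CStarAlgebra B] {u : G → X}
    {f : X → B} {x y : FreeStarAlgebra X} (h : UnitaryRel u x y) (v : G →* unitary B)
    (hf : ∀ g, f (u g) = v g) : eval f x = eval f y := by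
  cases h with
  | one => simp [eval_of, hf]
  | mul g k => simp [eval_of, hf]
  | star g => rw [map_star, eval_of, eval_of, hf, hf, map_inv]; rfl

theorem norm_unitary_le_one {B : Type*} [CStarAlgebra B] (u : unitary B) : ‖(u : B)‖ ≤ 1 := by
  -- The norm is 1 unless `B` is the zero algebra, where it is 0; hence only an inequality is
  -- claimed.
  nontriviality B
  exact (CStarRing.norm_coe_unitary u).le

theorem GroupCStar.hom_ext {G B : Type*} [Group G] [CStarAlgebra B]
    {φ ψ : GroupCStar G →⋆ₐ[ℂ] B}
    (h : ∀ g, φ (GroupCStar.unitaries G g : GroupCStar G) =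
      ψ (GroupCStar.unitaries G g : GroupCStar G)) : φ = ψ :=
  UniversalCStar.hom_ext h

namespace CrossedProduct

variable {A G B : Type*} [CStarAlgebra A] [Group G] [CStarAlgebra B] (α : G →* (A ≃⋆ₐ[ℂ] A))

theorem hom_ext {φ ψ : CrossedProduct α →⋆ₐ[ℂ] B} (h : ∀ a, φ (incl α a) = ψ (incl α a))
    (hu : ∀ g, φ (unitaries α g : CrossedProduct α) = ψ (unitaries α g : CrossedProduct α)) :
    φ = ψ :=
  UniversalCStar.hom_ext (Sum.rec h hu)

theorem covariance (g : G) (a : A) :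
    (unitaries α g : CrossedProduct α) * incl α a * star (unitaries α g : CrossedProduct α) =
      incl α (α g a) := by
  have h := mk_eq_mk (P := crossedPresentation α) (.cov g a)
  rwa [mk_mul, mk_mul, ← star_mk] at h

/-- The universal property of the crossed product: a covariant pair integrates. -/
def lift (φ : A →⋆ₐ[ℂ] B) (v : G →* unitary B)
    (h : ∀ g a, (v g : B) * φ a * star (v g : B) = φ (α g a)) : CrossedProduct α →⋆ₐ[ℂ] B :=
  UniversalCStar.lift (Sum.elim φ fun g => (v g : B))
    -- The norm bounds of the presentation cost nothing: `*`-homomorphisms are contractive and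
    -- unitaries have norm at most 1.
    (Sum.rec (fun a => NonUnitalStarAlgHom.norm_apply_le φ a) fun g => norm_unitary_le_one (v g))
    (fun x y hxy => by
      cases hxy with
      | alg hxy => exact hxy.eval_eq φ fun _ => rfl
      | grp hxy => exact hxy.eval_eq v fun _ => rfl
      | cov g a => simpa [eval_of, map_star] using h g a)

variable {α} {φ : A →⋆ₐ[ℂ] B} {v : G →* unitary B}
  (h : ∀ g a, (v g : B) * φ a * star (v g : B) = φ (α g a))

theorem lift_incl (a : A) : lift α φ v h (incl α a) = φ a := lift_gen _ _ _ (Sum.inl a)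

theorem lift_unitaries (g : G) : lift α φ v h (unitaries α g : CrossedProduct α) = v g :=
  lift_gen _ _ _ (Sum.inr g)

end CrossedProduct

namespace AmalgamatedFreeProduct

variable {C A₁ A₂ B : Type*} [CStarAlgebra C] [CStarAlgebra A₁] [CStarAlgebra A₂]
  [CStarAlgebra B] (i₁ : C →⋆ₐ[ℂ] A₁) (i₂ : C →⋆ₐ[ℂ] A₂)

theorem inl_comp_eq_inr_comp (c : C) : inl i₁ i₂ (i₁ c) = inr i₁ i₂ (i₂ c) :=
  mk_eq_mk (P := amalgamatedPresentation i₁ i₂) (.glue c)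

variable {i₁ i₂} in
theorem hom_ext {φ ψ : AmalgamatedFreeProduct i₁ i₂ →⋆ₐ[ℂ] B}
    (h₁ : ∀ a, φ (inl i₁ i₂ a) = ψ (inl i₁ i₂ a))
    (h₂ : ∀ a, φ (inr i₁ i₂ a) = ψ (inr i₁ i₂ a)) : φ = ψ :=
  UniversalCStar.hom_ext (Sum.rec h₁ h₂)

/-- The universal property of the amalgamated free product. -/
def lift (φ₁ : A₁ →⋆ₐ[ℂ] B) (φ₂ : A₂ →⋆ₐ[ℂ] B) (h : ∀ c, φ₁ (i₁ c) = φ₂ (i₂ c)) :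
    AmalgamatedFreeProduct i₁ i₂ →⋆ₐ[ℂ] B :=
  UniversalCStar.lift (Sum.elim φ₁ φ₂)
    (Sum.rec (fun a => NonUnitalStarAlgHom.norm_apply_le φ₁ a)
      fun a => NonUnitalStarAlgHom.norm_apply_le φ₂ a)
    (fun x y hxy => by
      cases hxy with
      | left hxy => exact hxy.eval_eq φ₁ fun _ => rfl
      | right hxy => exact hxy.eval_eq φ₂ fun _ => rfl
      | glue c => simpa [eval_of] using h c)

variable {i₁ i₂} {φ₁ : A₁ →⋆ₐ[ℂ] B} {φ₂ : A₂ →⋆ₐ[ℂ] B} (h : ∀ c, φ₁ (i₁ c) = φ₂ (i₂ c))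

theorem lift_inl (a : A₁) : lift i₁ i₂ φ₁ φ₂ h (inl i₁ i₂ a) = φ₁ a := lift_gen _ _ _ (Sum.inl a)

theorem lift_inr (a : A₂) : lift i₁ i₂ φ₁ φ₂ h (inr i₁ i₂ a) = φ₂ a := lift_gen _ _ _ (Sum.inr a)

end AmalgamatedFreeProduct

end UniversalProperties

/-! ### The unital free product and the free product of two actions. -/

namespace FreeProductCStar

variable {A₁ A₂ B : Type*} [CStarAlgebra A₁] [CStarAlgebra A₂] [CStarAlgebra B]

theorem hom_ext {φ ψ : FreeProductCStar A₁ A₂ →⋆ₐ[ℂ] B}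
    (h₁ : ∀ a, φ (inl A₁ A₂ a) = ψ (inl A₁ A₂ a))
    (h₂ : ∀ a, φ (inr A₁ A₂ a) = ψ (inr A₁ A₂ a)) : φ = ψ :=
  AmalgamatedFreeProduct.hom_ext h₁ h₂

/-- The universal property of the unital free product. -/
def lift (φ₁ : A₁ →⋆ₐ[ℂ] B) (φ₂ : A₂ →⋆ₐ[ℂ] B) : FreeProductCStar A₁ A₂ →⋆ₐ[ℂ] B :=
  -- Gluing over the scalars is automatic, since unital homomorphisms agree on `ℂ`.
  AmalgamatedFreeProduct.lift _ _ φ₁ φ₂ fun c =>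
    (AlgHomClass.commutes φ₁ c).trans (AlgHomClass.commutes φ₂ c).symm

theorem lift_inl (φ₁ : A₁ →⋆ₐ[ℂ] B) (φ₂ : A₂ →⋆ₐ[ℂ] B) (a : A₁) :
    lift φ₁ φ₂ (inl A₁ A₂ a) = φ₁ a :=
  AmalgamatedFreeProduct.lift_inl _ a

theorem lift_inr (φ₁ : A₁ →⋆ₐ[ℂ] B) (φ₂ : A₂ →⋆ₐ[ℂ] B) (a : A₂) :
    lift φ₁ φ₂ (inr A₁ A₂ a) = φ₂ a :=
  AmalgamatedFreeProduct.lift_inr _ a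

/-- The free product of two automorphisms, as an endomorphism. -/
def map (σ₁ : A₁ ≃⋆ₐ[ℂ] A₁) (σ₂ : A₂ ≃⋆ₐ[ℂ] A₂) :
    FreeProductCStar A₁ A₂ →⋆ₐ[ℂ] FreeProductCStar A₁ A₂ :=
  lift ((inl A₁ A₂).comp (σ₁ : A₁ →⋆ₐ[ℂ] A₁)) ((inr A₁ A₂).comp (σ₂ : A₂ →⋆ₐ[ℂ] A₂))

theorem map_inl (σ₁ : A₁ ≃⋆ₐ[ℂ] A₁) (σ₂ : A₂ ≃⋆ₐ[ℂ] A₂) (a : A₁) :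
    map σ₁ σ₂ (inl A₁ A₂ a) = inl A₁ A₂ (σ₁ a) := lift_inl _ _ a

theorem map_inr (σ₁ : A₁ ≃⋆ₐ[ℂ] A₁) (σ₂ : A₂ ≃⋆ₐ[ℂ] A₂) (a : A₂) :
    map σ₁ σ₂ (inr A₁ A₂ a) = inr A₁ A₂ (σ₂ a) := lift_inr _ _ a

/-- Functoriality, checked on the two factors. It makes the endomorphisms at `g` and `g⁻¹` mutually
inverse and gives multiplicativity in `g`. -/
theorem map_mul_mul (σ₁ τ₁ : A₁ ≃⋆ₐ[ℂ] A₁) (σ₂ τ₂ : A₂ ≃⋆ₐ[ℂ] A₂) :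
    map (σ₁ * τ₁) (σ₂ * τ₂) = (map σ₁ σ₂).comp (map τ₁ τ₂) :=
  hom_ext (fun a => by simp [map_inl]) (fun a => by simp [map_inr])

theorem map_one_one : map (1 : A₁ ≃⋆ₐ[ℂ] A₁) (1 : A₂ ≃⋆ₐ[ℂ] A₂) = StarAlgHom.id ℂ _ :=
  hom_ext (fun a => by simp [map_inl]) (fun a => by simp [map_inr])

variable {G : Type*} [Group G] (α₁ : G →* (A₁ ≃⋆ₐ[ℂ] A₁)) (α₂ : G →* (A₂ ≃⋆ₐ[ℂ] A₂))

/-- The free product of two actions. -/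
def action : G →* (FreeProductCStar A₁ A₂ ≃⋆ₐ[ℂ] FreeProductCStar A₁ A₂) where
  toFun g := StarAlgEquiv.ofStarAlgHom (map (α₁ g) (α₂ g)) (map (α₁ g⁻¹) (α₂ g⁻¹))
    (by rw [← map_mul_mul]; simp [map_one_one])
    (by rw [← map_mul_mul]; simp [map_one_one])
  map_one' := by
    ext a
    change map (α₁ 1) (α₂ 1) a = a
    rw [map_one, map_one, map_one_one]; rfl
  map_mul' g h := by
    ext a
    change map (α₁ (g * h)) (α₂ (g * h)) a = _
    rw [map_mul, map_mul, map_mul_mul]; rfl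

theorem extendsActions_action : ExtendsActions α₁ α₂ (action α₁ α₂) :=
  ⟨fun g a => map_inl (α₁ g) (α₂ g) a, fun g a => map_inr (α₁ g) (α₂ g) a⟩

end FreeProductCStar

/-! ### The comparison maps between the two universal algebras. -/

namespace ExtendsActions

open FreeProductCStar

variable {A₁ A₂ G : Type*} [CStarAlgebra A₁] [CStarAlgebra A₂] [Group G]
  {α₁ : G →* (A₁ ≃⋆ₐ[ℂ] A₁)} {α₂ : G →* (A₂ ≃⋆ₐ[ℂ] A₂)}
  {α β : G →* (FreeProductCStar A₁ A₂ ≃⋆ₐ[ℂ] FreeProductCStar A₁ A₂)}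

theorem unique (hα : ExtendsActions α₁ α₂ α) (hβ : ExtendsActions α₁ α₂ β) : α = β := by
  ext g a
  have h : (α g : _ →⋆ₐ[ℂ] FreeProductCStar A₁ A₂) = (β g : _ →⋆ₐ[ℂ] _) :=
    FreeProductCStar.hom_ext (fun a => (hα.1 g a).trans (hβ.1 g a).symm)
      fun a => (hα.2 g a).trans (hβ.2 g a).symm
  exact DFunLike.congr_fun h a

variable (α₁ α₂) in
/-- The amalgamated free product of the two crossed products. -/
abbrev Target :=
  AmalgamatedFreeProduct (CrossedProduct.groupIncl α₁) (CrossedProduct.groupIncl α₂)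

variable (α₁ α₂) in
-- Both sides are images of the same canonical unitary of `C*(G)`, which the amalgamation
-- identifies.
theorem inl_unitaries_eq_inr_unitaries (g : G) :
    (AmalgamatedFreeProduct.inl _ _ (CrossedProduct.unitaries α₁ g : CrossedProduct α₁) :
      Target α₁ α₂) =
      AmalgamatedFreeProduct.inr _ _ (CrossedProduct.unitaries α₂ g : CrossedProduct α₂) := by
  rw [← CrossedProduct.groupIncl_unitaries, ← CrossedProduct.groupIncl_unitaries,
    AmalgamatedFreeProduct.inl_comp_eq_inr_comp]

variable (α₁ α₂) in
/-- The free product of the coefficient algebras, mapped into the amalgamated free product. -/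
def coefficientHom : FreeProductCStar A₁ A₂ →⋆ₐ[ℂ] Target α₁ α₂ :=
  FreeProductCStar.lift ((AmalgamatedFreeProduct.inl _ _).comp (CrossedProduct.incl α₁))
    ((AmalgamatedFreeProduct.inr _ _).comp (CrossedProduct.incl α₂))

variable (α₁ α₂) in
/-- The common unitaries of the two crossed products in the amalgamated free product. -/
def unitaryRep : G →* unitary (Target α₁ α₂) where
  -- The left copy is an arbitrary choice; `unitaryRep_right` shows that the right copy gives the
  -- same element.
  toFun g := ⟨AmalgamatedFreeProduct.inl _ _ (CrossedProduct.unitaries α₁ g : CrossedProduct α₁),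
    Unitary.map_mem _ (CrossedProduct.unitaries α₁ g).2⟩
  map_one' := Subtype.ext (by simp)
  map_mul' g k := Subtype.ext (by simp)

variable (α₁ α₂) in
theorem unitaryRep_left (g : G) : (unitaryRep α₁ α₂ g : Target α₁ α₂) =
    AmalgamatedFreeProduct.inl _ _ (CrossedProduct.unitaries α₁ g : CrossedProduct α₁) := rfl

variable (α₁ α₂) in
theorem unitaryRep_right (g : G) : (unitaryRep α₁ α₂ g : Target α₁ α₂) =
    AmalgamatedFreeProduct.inr _ _ (CrossedProduct.unitaries α₂ g : CrossedProduct α₂) :=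
  inl_unitaries_eq_inr_unitaries α₁ α₂ g

variable (α₁ α₂) in
theorem coefficientHom_inl (a : A₁) : coefficientHom α₁ α₂ (inl A₁ A₂ a) =
    AmalgamatedFreeProduct.inl _ _ (CrossedProduct.incl α₁ a) := FreeProductCStar.lift_inl _ _ a

variable (α₁ α₂) in
theorem coefficientHom_inr (a : A₂) : coefficientHom α₁ α₂ (inr A₁ A₂ a) =
    AmalgamatedFreeProduct.inr _ _ (CrossedProduct.incl α₂ a) := FreeProductCStar.lift_inr _ _ a

/-- Conjugation by a unitary is an automorphism, so for fixed `g` both sides are `*`-homomorphisms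
in `a`. They need only be compared on `A₁` and `A₂`, where the identity is the image of the
covariance relation in `A_k ⋊ G`. -/
theorem coefficientHom_covariant (hα : ExtendsActions α₁ α₂ α) (g : G)
    (a : FreeProductCStar A₁ A₂) :
    (unitaryRep α₁ α₂ g : Target α₁ α₂) * coefficientHom α₁ α₂ a *
      star (unitaryRep α₁ α₂ g : Target α₁ α₂) = coefficientHom α₁ α₂ (α g a) := by
  have h : ((Unitary.conjStarAlgAut ℂ _ (unitaryRep α₁ α₂ g) :
      Target α₁ α₂ ≃⋆ₐ[ℂ] Target α₁ α₂) : _ →⋆ₐ[ℂ] _).comp (coefficientHom α₁ α₂) =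
      (coefficientHom α₁ α₂).comp (α g : _ →⋆ₐ[ℂ] _) := by
    refine FreeProductCStar.hom_ext (fun a => ?_) fun a => ?_
    · change (unitaryRep α₁ α₂ g : Target α₁ α₂) * coefficientHom α₁ α₂ _ *
        star (unitaryRep α₁ α₂ g : Target α₁ α₂) = coefficientHom α₁ α₂ (α g _)
      rw [hα.1, coefficientHom_inl, coefficientHom_inl, unitaryRep_left, ← CrossedProduct.covariance,
        map_mul, map_mul, map_star]
    · change (unitaryRep α₁ α₂ g : Target α₁ α₂) * coefficientHom α₁ α₂ _ *
        star (unitaryRep α₁ α₂ g : Target α₁ α₂) = coefficientHom α₁ α₂ (α g _)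
      -- The amalgamation enters here: the unitary must be read as coming from the second crossed
      -- product before its covariance relation applies.
      rw [hα.2, coefficientHom_inr, coefficientHom_inr, unitaryRep_right,
        ← CrossedProduct.covariance, map_mul, map_mul, map_star]
  exact DFunLike.congr_fun h a

/-- The canonical map of the crossed product of the free product into the amalgamated free
product of the crossed products. -/
def toAmalgam (hα : ExtendsActions α₁ α₂ α) : CrossedProduct α →⋆ₐ[ℂ] Target α₁ α₂ :=
  CrossedProduct.lift α (coefficientHom α₁ α₂) (unitaryRep α₁ α₂) hα.coefficientHom_covariant

/-- The canonical map of the left crossed product. -/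
def ofLeft (hα : ExtendsActions α₁ α₂ α) : CrossedProduct α₁ →⋆ₐ[ℂ] CrossedProduct α :=
  CrossedProduct.lift α₁ ((CrossedProduct.incl α).comp (inl A₁ A₂)) (CrossedProduct.unitaries α)
    fun g a => (CrossedProduct.covariance α g _).trans <| congrArg _ (hα.1 g a)

/-- The canonical map of the right crossed product. -/
def ofRight (hα : ExtendsActions α₁ α₂ α) : CrossedProduct α₂ →⋆ₐ[ℂ] CrossedProduct α :=
  CrossedProduct.lift α₂ ((CrossedProduct.incl α).comp (inr A₁ A₂)) (CrossedProduct.unitaries α)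
    fun g a => (CrossedProduct.covariance α g _).trans <| congrArg _ (hα.2 g a)

/-- The canonical map of the amalgamated free product of the crossed products into the crossed
product of the free product. -/
def ofAmalgam (hα : ExtendsActions α₁ α₂ α) : Target α₁ α₂ →⋆ₐ[ℂ] CrossedProduct α :=
  AmalgamatedFreeProduct.lift _ _ hα.ofLeft hα.ofRight fun c => by
    have h : hα.ofLeft.comp (CrossedProduct.groupIncl α₁) =
        hα.ofRight.comp (CrossedProduct.groupIncl α₂) :=
      -- Agreement on `C*(G)` reduces to its generators, which both maps send to the canonical
      -- unitaries of `CrossedProduct α`.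
      GroupCStar.hom_ext fun g => by
        simp only [StarAlgHom.comp_apply, CrossedProduct.groupIncl_unitaries]
        exact (CrossedProduct.lift_unitaries _ g).trans (CrossedProduct.lift_unitaries _ g).symm
    exact DFunLike.congr_fun h c

/-! ### The comparison maps on generators, and the isomorphism. -/

section

variable (hα : ExtendsActions α₁ α₂ α)

theorem toAmalgam_incl_inl (a : A₁) :
    hα.toAmalgam (CrossedProduct.incl α (inl A₁ A₂ a)) =
      AmalgamatedFreeProduct.inl _ _ (CrossedProduct.incl α₁ a) :=
  (CrossedProduct.lift_incl _ _).trans (coefficientHom_inl α₁ α₂ a)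

theorem toAmalgam_incl_inr (a : A₂) :
    hα.toAmalgam (CrossedProduct.incl α (inr A₁ A₂ a)) =
      AmalgamatedFreeProduct.inr _ _ (CrossedProduct.incl α₂ a) :=
  (CrossedProduct.lift_incl _ _).trans (coefficientHom_inr α₁ α₂ a)

theorem toAmalgam_unitaries (g : G) :
    hα.toAmalgam (CrossedProduct.unitaries α g : CrossedProduct α) = unitaryRep α₁ α₂ g :=
  CrossedProduct.lift_unitaries _ g

theorem ofAmalgam_inl_incl (a : A₁) :
    hα.ofAmalgam (AmalgamatedFreeProduct.inl _ _ (CrossedProduct.incl α₁ a)) =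
      CrossedProduct.incl α (inl A₁ A₂ a) :=
  (AmalgamatedFreeProduct.lift_inl _ _).trans (CrossedProduct.lift_incl _ a)

theorem ofAmalgam_inr_incl (a : A₂) :
    hα.ofAmalgam (AmalgamatedFreeProduct.inr _ _ (CrossedProduct.incl α₂ a)) =
      CrossedProduct.incl α (inr A₁ A₂ a) :=
  (AmalgamatedFreeProduct.lift_inr _ _).trans (CrossedProduct.lift_incl _ a)

theorem ofAmalgam_unitaryRep (g : G) :
    hα.ofAmalgam (unitaryRep α₁ α₂ g : Target α₁ α₂) = CrossedProduct.unitaries α g :=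
  (AmalgamatedFreeProduct.lift_inl _ _).trans (CrossedProduct.lift_unitaries _ g)

/-- `CrossedProduct α` is generated by `A₁`, `A₂` and the unitaries, each of which is sent to its
counterpart and back. -/
theorem ofAmalgam_comp_toAmalgam : hα.ofAmalgam.comp hα.toAmalgam = StarAlgHom.id ℂ _ := by
  have h : (hα.ofAmalgam.comp hα.toAmalgam).comp (CrossedProduct.incl α) =
      CrossedProduct.incl α :=
    FreeProductCStar.hom_ext
      (fun a => (congrArg _ (hα.toAmalgam_incl_inl a)).trans (hα.ofAmalgam_inl_incl a))
      fun a => (congrArg _ (hα.toAmalgam_incl_inr a)).trans (hα.ofAmalgam_inr_incl a)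
  exact CrossedProduct.hom_ext α (DFunLike.congr_fun h) fun g =>
    (congrArg _ (hα.toAmalgam_unitaries g)).trans (hα.ofAmalgam_unitaryRep g)

theorem toAmalgam_comp_ofAmalgam : hα.toAmalgam.comp hα.ofAmalgam = StarAlgHom.id ℂ _ := by
  have h₁ : (hα.toAmalgam.comp hα.ofAmalgam).comp (AmalgamatedFreeProduct.inl _ _) =
      AmalgamatedFreeProduct.inl _ _ :=
    CrossedProduct.hom_ext α₁
      (fun a => (congrArg _ (hα.ofAmalgam_inl_incl a)).trans (hα.toAmalgam_incl_inl a))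
      fun g => (congrArg _ (hα.ofAmalgam_unitaryRep g)).trans (hα.toAmalgam_unitaries g)
  have h₂ : (hα.toAmalgam.comp hα.ofAmalgam).comp (AmalgamatedFreeProduct.inr _ _) =
      AmalgamatedFreeProduct.inr _ _ :=
    CrossedProduct.hom_ext α₂
      (fun a => (congrArg _ (hα.ofAmalgam_inr_incl a)).trans (hα.toAmalgam_incl_inr a))
      fun g => by
        simp only [StarAlgHom.comp_apply]
        -- The right-hand unitaries are first rewritten as the common representation, on which both
        -- comparison maps are already known.
        rw [← unitaryRep_right, ofAmalgam_unitaryRep, toAmalgam_unitaries]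
  exact AmalgamatedFreeProduct.hom_ext (DFunLike.congr_fun h₁) (DFunLike.congr_fun h₂)

/-- The crossed product of the free product is the amalgamated free product of the crossed
products. -/
def equivAmalgam : CrossedProduct α ≃⋆ₐ[ℂ] Target α₁ α₂ :=
  StarAlgEquiv.ofStarAlgHom hα.toAmalgam hα.ofAmalgam hα.ofAmalgam_comp_toAmalgam
    hα.toAmalgam_comp_ofAmalgam

end

end ExtendsActions

end

/-! ### The main theorem. -/

theorem mainTheorem7 {A₁ A₂ G : Type*} [CStarAlgebra A₁] [CStarAlgebra A₂] [Group G]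
    (α₁ : G →* (A₁ ≃⋆ₐ[ℂ] A₁)) (α₂ : G →* (A₂ ≃⋆ₐ[ℂ] A₂)) :
    (∃! α : G →* (FreeProductCStar A₁ A₂ ≃⋆ₐ[ℂ] FreeProductCStar A₁ A₂),
      ExtendsActions α₁ α₂ α) ∧
    ∀ α : G →* (FreeProductCStar A₁ A₂ ≃⋆ₐ[ℂ] FreeProductCStar A₁ A₂),
      ExtendsActions α₁ α₂ α →
      ∃ Φ : CrossedProduct α ≃⋆ₐ[ℂ]
          AmalgamatedFreeProduct (CrossedProduct.groupIncl α₁) (CrossedProduct.groupIncl α₂),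
        (∀ a : A₁, Φ (CrossedProduct.incl α (FreeProductCStar.inl A₁ A₂ a)) =
          AmalgamatedFreeProduct.inl _ _ (CrossedProduct.incl α₁ a)) ∧
        (∀ a : A₂, Φ (CrossedProduct.incl α (FreeProductCStar.inr A₁ A₂ a)) =
          AmalgamatedFreeProduct.inr _ _ (CrossedProduct.incl α₂ a)) ∧
        (∀ g : G, Φ (CrossedProduct.unitaries α g : CrossedProduct α) =
          AmalgamatedFreeProduct.inl _ _ (CrossedProduct.unitaries α₁ g : CrossedProduct α₁)) ∧
        ∀ g : G, Φ (CrossedProduct.unitaries α g : CrossedProduct α) =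
          AmalgamatedFreeProduct.inr _ _ (CrossedProduct.unitaries α₂ g : CrossedProduct α₂) := by
  refine ⟨⟨_, FreeProductCStar.extendsActions_action α₁ α₂,
    fun β hβ => hβ.unique (FreeProductCStar.extendsActions_action α₁ α₂)⟩, fun α hα => ?_⟩
  -- The formula with `inl` holds as it stands because `unitaryRep` is defined by the left copy; the
  -- one with `inr` needs the amalgamation.
  exact ⟨hα.equivAmalgam, hα.toAmalgam_incl_inl, hα.toAmalgam_incl_inr, hα.toAmalgam_unitaries,
    fun g => (hα.toAmalgam_unitaries g).trans (ExtendsActions.unitaryRep_right α₁ α₂ g)⟩
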